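/- Let $Act$ be a set of atomic actions, $\surd\notin Act$ a label for successful termination, and let $A=Act\cup\{\surd\}$ be the set of labels. Consider the signature $\Sigma$ of BPA$_{\delta\varepsilon}$ with binary Kleene star: constants $a$ (for $a\in Act$), $\delta$, $\varepsilon$, and binary function symbols $+$, $\cdot$ and ${}^\ast$; let $T(\Sigma)$ be the set of its closed terms. Let $P$ be the transition system specification with the following rules, where $x_1,x_2,y,y_1,y_2$ are distinct variables, $a$ ranges over $Act$, and $v$ over $A$: $$a\xrightarrow{a}\varepsilon,\qquad \varepsilon\xrightarrow{\surd}\delta,\qquad \frac{x_1\xrightarrow{v}y}{x_1+x_2\xrightarrow{v}y},\qquad \frac{x_2\xrightarrow{v}y}{x_1+x_2\xrightarrow{v}y},$$ $$\frac{x_1\xrightarrow{v}y}{x_1\cdot x_2\xrightarrow{v}y\cdot x_2}\ (v\neq\surd),\qquad \frac{x_1\xrightarrow{\surd}y_1\quad x_2\xrightarrow{v}y_2}{x_1\cdot x_2\xrightarrow{v}y_2},$$ $$\frac{x_1\xrightarrow{v}y}{x_1{}^\ast x_2\xrightarrow{v}y\cdot(x_1{}^\ast x_2)}\ (v\neq\surd),\qquad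 \frac{x_2\xrightarrow{v}y}{x_1{}^\ast x_2\xrightarrow{v}y}.$$ A literal is an expression $t\xrightarrow{a}t'$ (positive) or $t\overset{a}{\nrightarrow}$ (negative) with terms $t,t'$ and $a\in A$; the literals $t\xrightarrow{a}t'$ and $t\overset{a}{\nrightarrow}$ deny each other. For a set $H$ of literals, $P\vdash\frac{H}{\alpha}$ means that there is a well-founded tree of literals with root $\alpha$ in which every node is a leaf in $H$, or is the conclusion of a substitution instance of a rule of $P$ whose set of premises is the set of nodes directly above it. A well-supported proof of a closed literal $\alpha$ is a well-founded tree of closed literals with root $\alpha$ such that for every node $\beta$, with $K$ the set of nodes directly above it, either $\frac{K}{\beta}$ is a closed substitution instance of a rule of $P$, or $\beta$ is negative and for every set $N$ of negative closed literals such that $P\vdash\frac{N}{\gamma}$ for a closed literal $\gamma$ denying $\beta$, some literal in $K$ denies one in $N$. Write $p\xrightarrow{a}q$, for closed terms $p,q$ and $a\in A$, if the literal $p\xrightarrow{a}q$ has a well-supported proof from $P$. Then $P$ is complete (for every closed term $p$ and $a\in A$, either $p\xrightarrow{a}q$ for some closed term $q$, or the negative literal $p\overset{a}{\nrightarrow}$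 has a well-supported proof from $P$), and on the labelled transition system $(T(\Sigma),\to)$ each of the following relations is a precongruence, i.e. a preorder $\sqsubseteq$ such that for every $f\in\Sigma$ of arity $k$, $p_i\sqsubseteq q_i$ for $i=1,\dots,k$ implies $f(p_1,\dots,p_k)\sqsubseteq f(q_1,\dots,q_k)$. Here $\mathrm{initials}(p)=\{a\in A\mid \exists p':p\xrightarrow{a}p'\}$. 1. For every $n\ge 1$, the $n$-nested simulation preorder: $p\sqsubseteq q$ iff $p\mathrel{R}q$ for some $n$-nested simulation $R$. A 1-nested simulation is a simulation, i.e. a relation $R$ such that $p\mathrel{R}q$ and $p\xrightarrow{a}p'$ imply $q\xrightarrow{a}q'$ for some $q'$ with $p'\mathrel{R}q'$; for $n\geq 2$ an $n$-nested simulation is a simulation $R$ whose inverse $R^{-1}$ is contained in an $(n-1)$-nested simulation. 2. The ready simulation preorder: $p\sqsubseteq q$ iff $p\mathrel{R}q$ for some simulation $R$ such that $p'\mathrel{R}q'$ and $a\notin\mathrm{initials}(p')$ imply $a\notin\mathrm{initials}(q')$. 3. The ready trace preorder: every ready trace of $p$ is one of $q$. A ready trace of $p_0$ is a sequence $X_0a_1X_1\cdots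 a_nX_n$ ($n\ge0$, $a_i\in A$, $X_i\subseteq A$) such that $p_0\xrightarrow{a_1}p_1\cdots\xrightarrow{a_n}p_n$ for some $p_1,\dots,p_n$ with $\mathrm{initials}(p_i)=X_i$ for $i=0,\dots,n$. 4. The readiness preorder: every ready pair of $p$ is one of $q$. A ready pair of $p_0$ is a pair $(a_1\cdots a_n,X)$ ($n\geq 0$, $a_i\in A$, $X\subseteq A$) such that $p_0\xrightarrow{a_1}\cdots\xrightarrow{a_n}p_n$ for some $p_n$ with $\mathrm{initials}(p_n)=X$. 5. The failure trace preorder: every failure trace of $p$ is one of $q$. Failure traces are defined as ready traces, with $\mathrm{initials}(p_i)\cap X_i=\emptyset$ in place of $\mathrm{initials}(p_i)=X_i$. 6. The failure preorder: every failure pair of $p$ is one of $q$. Failure pairs are defined as ready pairs, with $\mathrm{initials}(p_n)\cap X=\emptyset$ in place of $\mathrm{initials}(p_n)=X$. -/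

import Mathlib

/-! ### Labelled transition systems and their preorders -/

/-- A labelled transition system with processes `Pr` and actions `A`. -/
structure LTS (Pr : Type*) (A : Type*) where
  /-- `step p a q` is the transition `p -a-> q`. -/
  step : Pr → A → Pr → Prop

namespace LTS

variable {Pr A : Type*} (T : LTS Pr A)

/-- The actions `a` for which `p -a-> p'` for some `p'`. -/
def initials (p : Pr) : Set A := {a | ∃ p', T.step p a p'}

/-- `p -ς-> q` for a finite sequence `ς` of actions. -/
def steps : Pr → List A → Pr → Prop
  | p, [], q => p = q
  | p, a :: s, q => ∃ r, T.step p a r ∧ steps r s q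

/-- `(s, X)` is a ready pair of `p`. -/
def IsReadyPair (p : Pr) (s : List A) (X : Set A) : Prop :=
  ∃ q, T.steps p s q ∧ T.initials q = X

/-- `(s, X)` is a failure pair of `p`. -/
def IsFailurePair (p : Pr) (s : List A) (X : Set A) : Prop :=
  ∃ q, T.steps p s q ∧ T.initials q ∩ X = ∅

/-- `X₀ a₁ X₁ ⋯ aₙ Xₙ` is a ready trace of `p`; the sequence is given by `X₀` and the list
`[(a₁, X₁), …, (aₙ, Xₙ)]`. -/
def IsReadyTrace : Pr → Set A → List (A × Set A) → Prop
  | p, X, [] => T.initials p = X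
  | p, X, (a, Y) :: l => T.initials p = X ∧ ∃ p', T.step p a p' ∧ IsReadyTrace p' Y l

/-- `X₀ a₁ X₁ ⋯ aₙ Xₙ` is a failure trace of `p`; the sequence is given by `X₀` and the list
`[(a₁, X₁), …, (aₙ, Xₙ)]`. -/
def IsFailureTrace : Pr → Set A → List (A × Set A) → Prop
  | p, X, [] => T.initials p ∩ X = ∅
  | p, X, (a, Y) :: l => T.initials p ∩ X = ∅ ∧ ∃ p', T.step p a p' ∧ IsFailureTrace p' Y l

/-- The readiness preorder. -/
def readinessLE (p q : Pr) : Prop := ∀ s X, T.IsReadyPair p s X → T.IsReadyPair q s X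

/-- The failure preorder. -/
def failureLE (p q : Pr) : Prop := ∀ s X, T.IsFailurePair p s X → T.IsFailurePair q s X

/-- The ready trace preorder. -/
def readyTraceLE (p q : Pr) : Prop := ∀ X l, T.IsReadyTrace p X l → T.IsReadyTrace q X l

/-- The failure trace preorder. -/
def failureTraceLE (p q : Pr) : Prop := ∀ X l, T.IsFailureTrace p X l → T.IsFailureTrace q X l

/-- `R` is a simulation. -/
def IsSimulation (R : Pr → Pr → Prop) : Prop :=
  ∀ p q a p', R p q → T.step p a p' → ∃ q', T.step q a q' ∧ R p' q'

/-- `R` is a ready simulation. -/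
def IsReadySimulation (R : Pr → Pr → Prop) : Prop :=
  T.IsSimulation R ∧ ∀ p q a, R p q → (¬ ∃ p', T.step p a p') → ¬ ∃ q', T.step q a q'

/-- `R` is an `n`-nested simulation. The notion is meant for `n ≥ 1`; no relation is a `0`-nested
simulation. -/
def IsNestedSimulation : ℕ → (Pr → Pr → Prop) → Prop
  | 0, _ => False
  | 1, R => T.IsSimulation R
  | n + 2, R => T.IsSimulation R ∧
      ∃ S, IsNestedSimulation (n + 1) S ∧ ∀ p q, R p q → S q p

/-- The `n`-nested simulation preorder (`n ≥ 1`). -/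
def nestedSimulationLE (n : ℕ) (p q : Pr) : Prop := ∃ R, T.IsNestedSimulation n R ∧ R p q

/-- The ready simulation preorder. -/
def readySimulationLE (p q : Pr) : Prop := ∃ R, T.IsReadySimulation R ∧ R p q

end LTS

/-! ### Transition system specifications

A signature is an algebraic first-order language `L`, open terms over the variables `V` are
`L.Term V`, closed terms are `L.Term Empty`. -/

/-- Positive literals `t -a-> t'` and negative literals `t -a↛` over terms with variables in
`V`. -/
inductive TLiteral (L : FirstOrder.Language) (V : Type*) (A : Type*) where
  | pos (t : L.Term V) (a : A) (t' : L.Term V) : TLiteral L V A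
  | neg (t : L.Term V) (a : A) : TLiteral L V A

namespace TLiteral

variable {L : FirstOrder.Language} {V W A : Type*}

/-- Apply a substitution to a literal. -/
def subst (σ : V → L.Term W) : TLiteral L V A → TLiteral L W A
  | pos t a t' => pos (t.subst σ) a (t'.subst σ)
  | neg t a => neg (t.subst σ) a

/-- A closed literal, seen as a literal over `V`. -/
def ofClosed (α : TLiteral L Empty A) : TLiteral L V A := α.subst Empty.elim

/-- The literal is negative. -/
def IsNeg : TLiteral L V A → Prop
  | pos _ _ _ => False
  | neg _ _ => True

/-- The literals `t -a-> t'` and `t -a↛` deny each other. -/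
def Denies : TLiteral L V A → TLiteral L V A → Prop
  | pos t a _, neg s b => t = s ∧ a = b
  | neg t a, pos s b _ => t = s ∧ a = b
  | _, _ => False

end TLiteral

/-- A transition rule: a set of premises and a conclusion. -/
structure TRule (L : FirstOrder.Language) (V : Type*) (A : Type*) where
  premises : Set (TLiteral L V A)
  conclusion : TLiteral L V A

/-- A transition system specification over the signature `L`: a set of transition rules. -/
structure TSS (L : FirstOrder.Language) (V : Type*) (A : Type*) where
  rules : Set (TRule L V A)

namespace TSS

variable {L : FirstOrder.Language} {V A : Type*}

/-- `P.Provable H α`: there is a proof of the rule `H / α` from `P`, i.e. a well-founded tree with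
root `α` whose nodes are hypotheses from `H` or are obtained from the nodes above by a substitution
instance of a rule of `P`. (A partial substitution is total after extension by the identity.) -/
inductive Provable (P : TSS L V A) (H : Set (TLiteral L V A)) : TLiteral L V A → Prop
  | hyp (α : TLiteral L V A) (hα : α ∈ H) : Provable P H α
  | rule (r : TRule L V A) (hr : r ∈ P.rules) (σ : V → L.Term V)
      (h : ∀ β ∈ r.premises, Provable P H (β.subst σ)) : Provable P H (r.conclusion.subst σ)

/-- `P.WSProvable α`: there is a well-supported proof of the closed literal `α` from `P`. -/
inductive WSProvable (P : TSS L V A) : TLiteral L Empty A → Prop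
  | rule (r : TRule L V A) (hr : r ∈ P.rules) (σ : V → L.Term Empty)
      (h : ∀ β ∈ r.premises, WSProvable P (β.subst σ)) : WSProvable P (r.conclusion.subst σ)
  | negation (β : TLiteral L Empty A) (hβ : β.IsNeg) (K : Set (TLiteral L Empty A))
      (hK : ∀ κ ∈ K, WSProvable P κ)
      (h : ∀ (N : Set (TLiteral L Empty A)) (γ : TLiteral L Empty A),
        (∀ ν ∈ N, ν.IsNeg) → γ.Denies β →
        P.Provable (TLiteral.ofClosed '' N) (TLiteral.ofClosed γ) →
        ∃ κ ∈ K, ∃ ν ∈ N, κ.Denies ν) :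
      WSProvable P β

/-- `P` is complete: its associated transition relation decides every `t -a↛`. -/
def Complete (P : TSS L V A) : Prop :=
  ∀ (t : L.Term Empty) (a : A),
    (∃ t', P.WSProvable (.pos t a t')) ∨ P.WSProvable (.neg t a)

/-- The labelled transition system on closed terms given by the transition relation associated
to `P`. -/
def toLTS (P : TSS L V A) : LTS (L.Term Empty) A where
  step p a q := P.WSProvable (.pos p a q)

end TSS

/-- A relation on closed terms is a precongruence: it is a preorder that is preserved by all
function symbols of the signature. -/
structure IsPrecongruence {L : FirstOrder.Language} (r : L.Term Empty → L.Term Empty → Prop) :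
    Prop where
  refl : ∀ p, r p p
  trans : ∀ p q s, r p q → r q s → r p s
  func : ∀ {n : ℕ} (f : L.Functions n) (p q : Fin n → L.Term Empty),
    (∀ i, r (p i) (q i)) → r (.func f p) (.func f q)

/-! ### Basic process algebra with deadlock, empty process and binary Kleene star -/

namespace BPAStar

/-- Function symbols, indexed by their arity. -/
inductive Symb (Act : Type*) : ℕ → Type _
  | act (a : Act) : Symb Act 0
  | delta : Symb Act 0
  | eps : Symb Act 0
  | alt : Symb Act 2
  | seq : Symb Act 2
  | star : Symb Act 2

/-- The signature. -/
abbrev sig (Act : Type*) : FirstOrder.Language where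
  Functions := Symb Act
  Relations := fun _ => Empty

/-- Transition labels: atomic actions `some a`, and successful termination `none`. -/
abbrev Label (Act : Type*) := Option Act

variable {Act V : Type*}

/-- The atomic action `a`. -/
def act (a : Act) : (sig Act).Term V := .func (l := 0) (Symb.act a) ![]
/-- Deadlock. -/
def delta : (sig Act).Term V := .func (l := 0) Symb.delta ![]
/-- The empty process. -/
def eps : (sig Act).Term V := .func (l := 0) Symb.eps ![]
/-- Alternative composition. -/
def alt (s t : (sig Act).Term V) : (sig Act).Term V := .func (l := 2) Symb.alt ![s, t]
/-- Sequential composition. -/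
def seq (s t : (sig Act).Term V) : (sig Act).Term V := .func (l := 2) Symb.seq ![s, t]
/-- The binary Kleene star. -/
def star (s t : (sig Act).Term V) : (sig Act).Term V := .func (l := 2) Symb.star ![s, t]

/-- The transition rules, written with the variables `x₁ x₂ y y₁ y₂`. -/
inductive Rules (x₁ x₂ y y₁ y₂ : V) : TRule (sig Act) V (Label Act) → Prop
  | act (a : Act) : Rules x₁ x₂ y y₁ y₂ ⟨∅, .pos (act a) (some a) eps⟩
  | eps : Rules x₁ x₂ y y₁ y₂ ⟨∅, .pos eps none delta⟩
  | altLeft (v : Label Act) : Rules x₁ x₂ y y₁ y₂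
      ⟨{.pos (.var x₁) v (.var y)}, .pos (alt (.var x₁) (.var x₂)) v (.var y)⟩
  | altRight (v : Label Act) : Rules x₁ x₂ y y₁ y₂
      ⟨{.pos (.var x₂) v (.var y)}, .pos (alt (.var x₁) (.var x₂)) v (.var y)⟩
  | seqLeft (v : Label Act) (hv : v ≠ none) : Rules x₁ x₂ y y₁ y₂
      ⟨{.pos (.var x₁) v (.var y)},
        .pos (seq (.var x₁) (.var x₂)) v (seq (.var y) (.var x₂))⟩
  | seqRight (v : Label Act) : Rules x₁ x₂ y y₁ y₂
      ⟨{.pos (.var x₁) none (.var y₁), .pos (.var x₂) v (.var y₂)},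
        .pos (seq (.var x₁) (.var x₂)) v (.var y₂)⟩
  | starLeft (v : Label Act) (hv : v ≠ none) : Rules x₁ x₂ y y₁ y₂
      ⟨{.pos (.var x₁) v (.var y)},
        .pos (star (.var x₁) (.var x₂)) v (seq (.var y) (star (.var x₁) (.var x₂)))⟩
  | starRight (v : Label Act) : Rules x₁ x₂ y y₁ y₂
      ⟨{.pos (.var x₂) v (.var y)}, .pos (star (.var x₁) (.var x₂)) v (.var y)⟩

/-- The transition system specification. -/
def tss (Act : Type*) {V : Type*} (x₁ x₂ y y₁ y₂ : V) : TSS (sig Act) V (Label Act) where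
  rules := {r | Rules x₁ x₂ y y₁ y₂ r}

end BPAStar

/-! ### Completeness of positive transition system specifications -/

namespace TLiteral

variable {L : FirstOrder.Language} {V W X A : Type*}

/-! Completeness: no rule has a negative premise, so a proof of a positive literal from negative
hypotheses never uses them. Hence if `t` has no `a`-transition, nothing that denies `t -a↛` is
provable, and `t -a↛` is well-supported with no premises at all. The transition relation itself is
the inductive relation `Step`.

Branching preorders: each has the form "related by a simulation contained in `S`", with `S` itself a
precongruence: the full relation for simulation, the converse of the preceding preorder for nested
simulation, reverse inclusion of initials for ready simulation. Closing such a simulation under the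
binary operators gives a simulation again, still contained in `S`
(`isPrecongruence_simulationWithinLE`).

Linear preorders: each is an inclusion of passed linear tests, where a class `M` of observations of
initials is allowed along the path and a class `L` at its end. The initials of a composite are a
function of those of its arguments, and the classes used decompose along these functions
(`Compositional`). A run of `p · q` stays in `p`, or moves in `p` until `p` terminates and then
continues in `q`. A test passed by `p · q` therefore yields one test `ψ` of `p` that records
everything needed along that run; one test is needed because its demands concern the same path. A
process passing `ψ`, followed by one above `q`, passes the original test
(`exists_test_of_test_seq`). A left move of `star p q` reaches `p₁ · star p q` with a test one
shorter left to pass, so the star follows by induction on test depth. -/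

theorem isNeg_subst (σ : V → L.Term W) (α : TLiteral L V A) : (α.subst σ).IsNeg ↔ α.IsNeg := by
  cases α <;> rfl

theorem _root_.FirstOrder.Language.Term.subst_comp_subst (σ : V → L.Term W) (τ : W → L.Term X)
    (t : L.Term V) : (t.subst σ).subst τ = t.subst fun v => (σ v).subst τ := by
  induction t with
  | var => rfl
  | func f ts ih => simp only [FirstOrder.Language.Term.subst, ih]

theorem _root_.FirstOrder.Language.Term.subst_of_isEmpty (σ : Empty → L.Term Empty)
    (t : L.Term Empty) : t.subst σ = t := by
  induction t with
  | var v => exact v.elim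
  | func f ts ih => simp only [FirstOrder.Language.Term.subst, ih]

theorem subst_subst (σ : V → L.Term W) (τ : W → L.Term X) (α : TLiteral L V A) :
    (α.subst σ).subst τ = α.subst fun v => (σ v).subst τ := by
  cases α <;> simp only [subst, FirstOrder.Language.Term.subst_comp_subst]

theorem ofClosed_subst (τ : V → L.Term Empty) (α : TLiteral L Empty A) :
    (ofClosed α : TLiteral L V A).subst τ = α := by
  rw [ofClosed, subst_subst]
  cases α <;> simp only [subst, FirstOrder.Language.Term.subst_of_isEmpty]

end TLiteral

namespace TSS

variable {L : FirstOrder.Language} {V A : Type*}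

/-- No rule has a negative premise. -/
def Positive (P : TSS L V A) : Prop := ∀ r ∈ P.rules, ∀ β ∈ r.premises, ¬ β.IsNeg

/-- Going down from a positive root only positive literals occur, so the negative hypotheses are
never reached. Closing all terms with `τ` turns the tree into a well-supported proof. -/
theorem Provable.wsProvable {P : TSS L V A} (hP : P.Positive) {H : Set (TLiteral L V A)}
    (hH : ∀ α ∈ H, α.IsNeg) (τ : V → L.Term Empty) {α : TLiteral L V A} (h : P.Provable H α)
    (hα : ¬ α.IsNeg) : P.WSProvable (α.subst τ) := by
  induction h with
  | hyp α h => exact absurd (hH α h) hα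
  | rule r hr σ _ ih =>
    rw [TLiteral.subst_subst]
    refine WSProvable.rule r hr _ fun β hβ => ?_
    rw [← TLiteral.subst_subst]
    exact ih β hβ fun h => hP r hr β hβ ((TLiteral.isNeg_subst σ β).1 h)

theorem Positive.complete {P : TSS L V A} (hP : P.Positive) (τ : V → L.Term Empty) :
    P.Complete := by
  intro t a
  refine or_iff_not_imp_left.2 fun hpos => ?_
  -- With `K` empty, the support condition can only hold vacuously: no denying literal may be
  -- provable from negative hypotheses.
  refine WSProvable.negation _ trivial ∅ (fun κ hκ => hκ.elim) fun N γ hN hγ hpr => ?_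
  cases γ with
  | neg => exact hγ.elim
  | pos s b s' =>
    obtain ⟨rfl, rfl⟩ := hγ
    refine absurd ⟨s', ?_⟩ hpos
    have h := hpr.wsProvable hP (τ := τ) ?_ (fun h => h)
    · rwa [TLiteral.ofClosed_subst] at h
    · rintro _ ⟨ν, hν, rfl⟩
      exact (TLiteral.isNeg_subst _ ν).2 (hN ν hν)

end TSS

/-! ### Simulations contained in a given relation -/

namespace LTS

variable {Pr A : Type*} (T : LTS Pr A)

/-- `p` and `q` are related by a simulation contained in `S`. -/
def simulationWithinLE (S : Pr → Pr → Prop) (p q : Pr) : Prop :=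
  ∃ R, T.IsSimulation R ∧ (∀ p q, R p q → S p q) ∧ R p q

variable {T} {S : Pr → Pr → Prop}

theorem isSimulation_simulationWithinLE : T.IsSimulation (T.simulationWithinLE S) := by
  rintro p q a p' ⟨R, hR, hS, hpq⟩ hp
  obtain ⟨q', hq, h⟩ := hR p q a p' hpq hp
  exact ⟨q', hq, R, hR, hS, h⟩

theorem simulationWithinLE_le {p q : Pr} (h : T.simulationWithinLE S p q) : S p q := by
  obtain ⟨R, _, hS, hpq⟩ := h
  exact hS p q hpq

theorem simulationWithinLE_refl (hS : ∀ p, S p p) (p : Pr) : T.simulationWithinLE S p p :=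
  ⟨Eq, fun _ _ _ p' h hp => h ▸ ⟨p', hp, rfl⟩, fun p _ h => h ▸ hS p, rfl⟩

theorem simulationWithinLE_trans (hS : ∀ p q s, S p q → S q s → S p s) {p q s : Pr}
    (h₁ : T.simulationWithinLE S p q) (h₂ : T.simulationWithinLE S q s) :
    T.simulationWithinLE S p s := by
  obtain ⟨R₁, hR₁, hS₁, hpq⟩ := h₁
  obtain ⟨R₂, hR₂, hS₂, hqs⟩ := h₂
  refine ⟨fun p s => ∃ q, R₁ p q ∧ R₂ q s, ?_, ?_, q, hpq, hqs⟩
  · rintro p s a p' ⟨q, h₁, h₂⟩ hp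
    obtain ⟨q', hq, h₁'⟩ := hR₁ p q a p' h₁ hp
    obtain ⟨s', hs, h₂'⟩ := hR₂ q s a q' h₂ hq
    exact ⟨s', hs, q', h₁', h₂'⟩
  · rintro p s ⟨q, h₁, h₂⟩
    exact hS p q s (hS₁ p q h₁) (hS₂ q s h₂)

theorem nestedSimulationLE_one :
    T.nestedSimulationLE 1 = T.simulationWithinLE fun _ _ => True := by
  funext p q
  exact propext ⟨fun ⟨R, hR, h⟩ => ⟨R, hR, fun _ _ _ => trivial, h⟩,
    fun ⟨R, hR, _, h⟩ => ⟨R, hR, h⟩⟩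

/-- Nested simulations are closed under unions. This makes the preorder the largest one, so that
containment of inverses can be tested pointwise against it in `nestedSimulationLE_succ`. -/
theorem isNestedSimulation_nestedSimulationLE (n : ℕ) :
    T.IsNestedSimulation (n + 1) (T.nestedSimulationLE (n + 1)) := by
  induction n with
  | zero =>
    rintro p q a p' ⟨R, hR, hpq⟩ hp
    obtain ⟨q', hq, h⟩ := hR p q a p' hpq hp
    exact ⟨q', hq, R, hR, h⟩
  | succ n ih =>
    refine ⟨?_, _, ih, ?_⟩
    · rintro p q a p' ⟨R, hR, hpq⟩ hp
      obtain ⟨q', hq, h⟩ := hR.1 p q a p' hpq hp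
      exact ⟨q', hq, R, hR, h⟩
    · rintro p q ⟨R, ⟨_, S, hS, hRS⟩, hpq⟩
      exact ⟨S, hS, hRS p q hpq⟩

theorem nestedSimulationLE_succ (n : ℕ) :
    T.nestedSimulationLE (n + 2) =
      T.simulationWithinLE fun p q => T.nestedSimulationLE (n + 1) q p := by
  funext p q
  refine propext ⟨?_, ?_⟩
  · rintro ⟨R, ⟨hR, S, hS, hRS⟩, h⟩
    exact ⟨R, hR, fun p q hpq => ⟨S, hS, hRS p q hpq⟩, h⟩
  · rintro ⟨R, hR, hS, h⟩
    exact ⟨R, ⟨hR, _, isNestedSimulation_nestedSimulationLE n, hS⟩, h⟩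

theorem readySimulationLE_eq :
    T.readySimulationLE = T.simulationWithinLE fun p q => T.initials q ⊆ T.initials p := by
  funext p q
  refine propext ⟨?_, ?_⟩
  · rintro ⟨R, ⟨hR, hI⟩, h⟩
    exact ⟨R, hR, fun p q hpq a ha => by_contra fun hp => hI p q a hpq hp ha, h⟩
  · rintro ⟨R, hR, hI, h⟩
    exact ⟨R, ⟨hR, fun p q a hpq hp hq => hp (hI p q hpq hq)⟩, h⟩

/-! ### Linear tests -/

variable (T) in
/-- Linear tests of depth at most `k`: a test observes the initials along a path of at most `k`
transitions. The observations are properties of sets of initials, taken from `M` at the intermediate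
states and from `L` at the last one. -/
inductive Test (M L : Set (Set (Set A))) : ℕ → (Pr → Prop) → Prop
  | last (k : ℕ) (o : Set (Set A)) (ho : o ∈ L) : Test M L k fun p => T.initials p ∈ o
  | step (k : ℕ) (o : Set (Set A)) (ho : o ∈ M) (a : A) (φ : Pr → Prop) (hφ : Test M L k φ) :
      Test M L (k + 1) fun p => T.initials p ∈ o ∧ ∃ p', T.step p a p' ∧ φ p'

variable (T) in
/-- Every test of depth at most `k` that `p` passes is passed by `q`. -/
def testLE (M L : Set (Set (Set A))) (k : ℕ) (p q : Pr) : Prop :=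
  ∀ φ, T.Test M L k φ → φ p → φ q

variable {M L : Set (Set (Set A))}

theorem Test.succ {k : ℕ} {φ : Pr → Prop} (h : T.Test M L k φ) : T.Test M L (k + 1) φ := by
  induction h with
  | last k o ho => exact .last _ o ho
  | step k o ho a φ _ ih => exact .step _ o ho a φ ih

theorem testLE.of_succ {k : ℕ} {p q : Pr} (h : T.testLE M L (k + 1) p q) : T.testLE M L k p q :=
  fun φ hφ => h φ hφ.succ

/-- The observation of one exact set of initials. -/
def exactly (X : Set A) : Set (Set A) := {X}

/-- The observation of a set of refused actions. -/
def refuses (X : Set A) : Set (Set A) := {I | I ∩ X = ∅}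

/-! ### Trace and failure semantics as test preorders -/

theorem test_isReadyTrace (X : Set A) (l : List (A × Set A)) :
    T.Test (Set.range exactly) (Set.range exactly) l.length fun p => T.IsReadyTrace p X l := by
  induction l generalizing X with
  | nil => exact .last 0 (exactly X) ⟨X, rfl⟩
  | cons b l ih => exact .step _ (exactly X) (Set.mem_range_self X) b.1 _ (ih b.2)

theorem Test.exists_isReadyTrace {k : ℕ} {φ : Pr → Prop}
    (h : T.Test (Set.range exactly) (Set.range exactly) k φ) :
    ∃ X l, φ = fun p => T.IsReadyTrace p X l := by
  induction h with
  | last k o ho =>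
    obtain ⟨X, rfl⟩ := ho
    exact ⟨X, [], rfl⟩
  | step k o ho a φ _ ih =>
    obtain ⟨X, rfl⟩ := ho
    obtain ⟨Y, l, rfl⟩ := ih
    exact ⟨X, (a, Y) :: l, rfl⟩

theorem readyTraceLE_eq :
    T.readyTraceLE = fun p q => ∀ k, T.testLE (Set.range exactly) (Set.range exactly) k p q := by
  funext p q
  refine propext ⟨fun h k φ hφ => ?_, fun h X l => h _ _ (test_isReadyTrace X l)⟩
  obtain ⟨X, l, rfl⟩ := hφ.exists_isReadyTrace
  exact h X l

theorem test_isFailureTrace (X : Set A) (l : List (A × Set A)) :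
    T.Test (Set.range refuses) (Set.range refuses) l.length fun p => T.IsFailureTrace p X l := by
  induction l generalizing X with
  | nil => exact .last 0 (refuses X) ⟨X, rfl⟩
  | cons b l ih => exact .step _ (refuses X) (Set.mem_range_self X) b.1 _ (ih b.2)

theorem Test.exists_isFailureTrace {k : ℕ} {φ : Pr → Prop}
    (h : T.Test (Set.range refuses) (Set.range refuses) k φ) :
    ∃ X l, φ = fun p => T.IsFailureTrace p X l := by
  induction h with
  | last k o ho =>
    obtain ⟨X, rfl⟩ := ho
    exact ⟨X, [], rfl⟩
  | step k o ho a φ _ ih =>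
    obtain ⟨X, rfl⟩ := ho
    obtain ⟨Y, l, rfl⟩ := ih
    exact ⟨X, (a, Y) :: l, rfl⟩

theorem failureTraceLE_eq :
    T.failureTraceLE = fun p q => ∀ k, T.testLE (Set.range refuses) (Set.range refuses) k p q := by
  funext p q
  refine propext ⟨fun h k φ hφ => ?_, fun h X l => h _ _ (test_isFailureTrace X l)⟩
  obtain ⟨X, l, rfl⟩ := hφ.exists_isFailureTrace
  exact h X l

theorem test_steps {o : Set (Set A)} (ho : o ∈ L) (s : List A) :
    T.Test {Set.univ} L s.length fun p => ∃ q, T.steps p s q ∧ T.initials q ∈ o := by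
  induction s with
  | nil => simpa [steps] using Test.last (T := T) (M := {Set.univ}) 0 o ho
  | cons a s ih =>
    have h := Test.step _ Set.univ (Set.mem_singleton _) a _ ih
    refine (congrArg (T.Test _ _ _) (funext fun p => propext ?_)).mpr h
    simp only [steps, Set.mem_univ, true_and]
    exact ⟨fun ⟨q, ⟨r, hr, hs⟩, hq⟩ => ⟨r, hr, q, hs, hq⟩,
      fun ⟨r, hr, q, hs, hq⟩ => ⟨q, ⟨r, hr, hs⟩, hq⟩⟩

theorem Test.exists_steps {k : ℕ} {φ : Pr → Prop} (h : T.Test {Set.univ} L k φ) :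
    ∃ s, ∃ o ∈ L, ∀ p, φ p ↔ ∃ q, T.steps p s q ∧ T.initials q ∈ o := by
  induction h with
  | last k o ho => exact ⟨[], o, ho, fun p => by simp [steps]⟩
  | step k o ho a φ _ ih =>
    obtain rfl : o = Set.univ := ho
    obtain ⟨s, o, ho, h⟩ := ih
    refine ⟨a :: s, o, ho, fun p => ?_⟩
    simp only [steps, Set.mem_univ, true_and, h]
    exact ⟨fun ⟨r, hr, q, hs, hq⟩ => ⟨q, ⟨r, hr, hs⟩, hq⟩,
      fun ⟨q, ⟨r, hr, hs⟩, hq⟩ => ⟨r, hr, q, hs, hq⟩⟩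

/-- The extra final observation `Set.univ` leaves the preorder unchanged. It provides `M ⊆ L` and a
final observation that holds everywhere. -/
theorem readinessLE_eq :
    T.readinessLE =
      fun p q => ∀ k, T.testLE {Set.univ} (Set.range exactly ∪ {Set.univ}) k p q := by
  funext p q
  refine propext ⟨fun h k φ hφ hp => ?_, fun h s X =>
    h _ _ (test_steps (o := exactly X) (.inl (Set.mem_range_self X)) s)⟩
  obtain ⟨s, o, _, hiff⟩ := hφ.exists_steps
  obtain ⟨p', hs, ho⟩ := (hiff p).1 hp
  -- Whatever `o` is, the ready pair formed with the exact initials of `p'` gives a `q'` with the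
  -- same initials, hence in `o`.
  obtain ⟨q', hs', ho'⟩ := h s _ ⟨p', hs, rfl⟩
  exact (hiff q).2 ⟨q', hs', ho' ▸ ho⟩

theorem failureLE_eq :
    T.failureLE = fun p q => ∀ k, T.testLE {Set.univ} (Set.range refuses) k p q := by
  funext p q
  refine propext ⟨fun h k φ hφ hp => ?_, fun h s X =>
    h _ _ (test_steps (o := refuses X) (Set.mem_range_self X) s)⟩
  obtain ⟨s, _, ⟨X, rfl⟩, hiff⟩ := hφ.exists_steps
  exact (hiff q).2 (h s X ((hiff p).1 hp))

end LTS

/-! ### Observations of sets of initials that decompose along binary operations -/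

/-- Every observation in `C` of a value of `f` can be enforced by observations in `C` of the two
arguments. -/
def Decomposes {A : Type*} (f : Set A → Set A → Set A) (C : Set (Set (Set A))) : Prop :=
  ∀ o ∈ C, ∀ I J, f I J ∈ o → ∃ o₁ ∈ C, ∃ o₂ ∈ C, I ∈ o₁ ∧ J ∈ o₂ ∧
    ∀ I' ∈ o₁, ∀ J' ∈ o₂, f I' J' ∈ o

namespace Decomposes

variable {A : Type*} {f : Set A → Set A → Set A} {C D : Set (Set (Set A))}

theorem union (hC : Decomposes f C) (hD : Decomposes f D) : Decomposes f (C ∪ D) := by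
  rintro o (ho | ho) I J h
  · obtain ⟨o₁, h₁, o₂, h₂, h⟩ := hC o ho I J h
    exact ⟨o₁, .inl h₁, o₂, .inl h₂, h⟩
  · obtain ⟨o₁, h₁, o₂, h₂, h⟩ := hD o ho I J h
    exact ⟨o₁, .inr h₁, o₂, .inr h₂, h⟩

theorem univ : Decomposes f {Set.univ} := by
  rintro o rfl I J _
  exact ⟨_, rfl, _, rfl, trivial, trivial, fun _ _ _ _ => trivial⟩

theorem exactly : Decomposes f (Set.range LTS.exactly) := by
  rintro _ ⟨X, rfl⟩ I J h
  refine ⟨_, ⟨I, rfl⟩, _, ⟨J, rfl⟩, rfl, rfl, ?_⟩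
  rintro _ rfl _ rfl
  exact h

end Decomposes

/-! ### The transition system of basic process algebra -/

namespace BPAStar

variable {Act V W : Type*}

theorem subst_act (a : Act) (σ : V → (sig Act).Term W) : (act a).subst σ = act a := by
  simp only [act, FirstOrder.Language.Term.subst]
  congr 1
  exact Subsingleton.elim _ _

theorem subst_delta (σ : V → (sig Act).Term W) : (delta : (sig Act).Term V).subst σ = delta := by
  simp only [delta, FirstOrder.Language.Term.subst]
  congr 1
  exact Subsingleton.elim _ _

theorem subst_eps (σ : V → (sig Act).Term W) : (eps : (sig Act).Term V).subst σ = eps := by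
  simp only [eps, FirstOrder.Language.Term.subst]
  congr 1
  exact Subsingleton.elim _ _

theorem subst_alt (s t : (sig Act).Term V) (σ : V → (sig Act).Term W) :
    (alt s t).subst σ = alt (s.subst σ) (t.subst σ) := by
  simp only [alt, FirstOrder.Language.Term.subst]
  congr 1
  funext i
  fin_cases i <;> rfl

theorem subst_seq (s t : (sig Act).Term V) (σ : V → (sig Act).Term W) :
    (seq s t).subst σ = seq (s.subst σ) (t.subst σ) := by
  simp only [seq, FirstOrder.Language.Term.subst]
  congr 1
  funext i
  fin_cases i <;> rfl

theorem subst_star (s t : (sig Act).Term V) (σ : V → (sig Act).Term W) :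
    (star s t).subst σ = star (s.subst σ) (t.subst σ) := by
  simp only [star, FirstOrder.Language.Term.subst]
  congr 1
  funext i
  fin_cases i <;> rfl

/-- Closed terms. -/
abbrev ClosedTerm (Act : Type*) := (sig Act).Term Empty

/-- The transition relation generated by the rules. -/
inductive Step : ClosedTerm Act → Label Act → ClosedTerm Act → Prop
  | act (a : Act) : Step (act a) (some a) eps
  | eps : Step eps none delta
  | altLeft {p q p' : ClosedTerm Act} {v : Label Act} (h : Step p v p') : Step (alt p q) v p'
  | altRight {p q q' : ClosedTerm Act} {v : Label Act} (h : Step q v q') : Step (alt p q) v q'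
  | seqLeft {p q p' : ClosedTerm Act} {v : Label Act} (hv : v ≠ none) (h : Step p v p') :
      Step (seq p q) v (seq p' q)
  | seqRight {p q p' q' : ClosedTerm Act} {v : Label Act} (h : Step p none p') (h' : Step q v q') :
      Step (seq p q) v q'
  | starLeft {p q p' : ClosedTerm Act} {v : Label Act} (hv : v ≠ none) (h : Step p v p') :
      Step (star p q) v (seq p' (star p q))
  | starRight {p q q' : ClosedTerm Act} {v : Label Act} (h : Step q v q') : Step (star p q) v q'

/-- The transition system on closed terms. -/
def lts (Act : Type*) : LTS (ClosedTerm Act) (Label Act) where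
  step := Step

/-! ### Well-supported transitions coincide with `Step` -/

section TSS

variable {x₁ x₂ y y₁ y₂ : V}

theorem positive_tss : (tss Act x₁ x₂ y y₁ y₂).Positive := by
  rintro r hr β hβ
  cases hr <;> simp only [Set.mem_empty_iff_false, Set.mem_singleton_iff, Set.mem_insert_iff] at hβ
  case seqRight => rcases hβ with rfl | rfl <;> exact id
  all_goals subst hβ; exact id

theorem step_of_wsProvable {p q : ClosedTerm Act} {v : Label Act}
    (h : (tss Act x₁ x₂ y y₁ y₂).WSProvable (.pos p v q)) : Step p v q := by
  generalize hα : TLiteral.pos p v q = α at h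
  induction h generalizing p v q with
  | negation β hβ =>
    subst hα
    exact hβ.elim
  | rule r hr σ _ ih =>
    cases hr
    all_goals
      simp only [TLiteral.subst, subst_act, subst_eps, subst_delta, subst_alt, subst_seq, subst_star,
        TLiteral.pos.injEq] at hα
      obtain ⟨rfl, rfl, rfl⟩ := hα
    · exact .act _
    · exact .eps
    · exact .altLeft (ih _ rfl rfl)
    · exact .altRight (ih _ rfl rfl)
    · rename_i hv _
      exact .seqLeft hv (ih _ rfl rfl)
    · exact .seqRight (ih _ (.inl rfl) rfl) (ih _ (.inr rfl) rfl)
    · rename_i hv _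
      exact .starLeft hv (ih _ rfl rfl)
    · exact .starRight (ih _ rfl rfl)

/-- Distinctness of the variables allows their values to be prescribed independently. -/
theorem exists_substitution (hV : [x₁, x₂, y, y₁, y₂].Nodup) (t₁ t₂ s s₁ s₂ : ClosedTerm Act) :
    ∃ σ : V → ClosedTerm Act, σ x₁ = t₁ ∧ σ x₂ = t₂ ∧ σ y = s ∧ σ y₁ = s₁ ∧ σ y₂ = s₂ := by
  classical
  refine ⟨fun v => if v = x₁ then t₁ else if v = x₂ then t₂ else if v = y then s else
    if v = y₁ then s₁ else s₂, ?_⟩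
  simp only [List.nodup_cons, List.mem_cons, List.not_mem_nil, or_false, not_or] at hV
  obtain ⟨⟨h₁, h₂, h₃, h₄⟩, ⟨h₅, h₆, h₇⟩, ⟨h₈, h₉⟩, h, -⟩ := hV
  simp [Ne.symm h₁, Ne.symm h₂, Ne.symm h₃, Ne.symm h₄, Ne.symm h₅, Ne.symm h₆, Ne.symm h₇,
    Ne.symm h₈, Ne.symm h₉, Ne.symm h]

theorem wsProvable_of_step (hV : [x₁, x₂, y, y₁, y₂].Nodup) {p q : ClosedTerm Act} {v : Label Act}
    (h : Step p v q) : (tss Act x₁ x₂ y y₁ y₂).WSProvable (.pos p v q) := by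
  -- To apply a rule it suffices to prescribe the values of the five variables; those not occurring
  -- in the rule get arbitrary values below.
  have key : ∀ {r : TRule (sig Act) V (Label Act)} (_ : Rules x₁ x₂ y y₁ y₂ r)
      (t₁ t₂ s s₁ s₂ : ClosedTerm Act) (α : TLiteral (sig Act) Empty (Label Act)),
      (∀ σ : V → ClosedTerm Act, σ x₁ = t₁ → σ x₂ = t₂ → σ y = s → σ y₁ = s₁ → σ y₂ = s₂ →
        (∀ β ∈ r.premises, (tss Act x₁ x₂ y y₁ y₂).WSProvable (β.subst σ)) ∧
          r.conclusion.subst σ = α) →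
      (tss Act x₁ x₂ y y₁ y₂).WSProvable α := by
    intro r hr t₁ t₂ s s₁ s₂ α h
    obtain ⟨σ, h₁, h₂, h₃, h₄, h₅⟩ := exists_substitution hV t₁ t₂ s s₁ s₂
    obtain ⟨hprem, rfl⟩ := h σ h₁ h₂ h₃ h₄ h₅
    exact TSS.WSProvable.rule (P := tss Act x₁ x₂ y y₁ y₂) r hr σ hprem
  induction h with
  | act a =>
    refine key (.act a) delta delta delta delta delta _ fun σ _ _ _ _ _ => ⟨by simp, ?_⟩
    simp only [TLiteral.subst, subst_act, subst_eps]
  | eps =>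
    refine key .eps delta delta delta delta delta _ fun σ _ _ _ _ _ => ⟨by simp, ?_⟩
    simp only [TLiteral.subst, subst_delta, subst_eps]
  | @altLeft p q p' v _ ih =>
    refine key (.altLeft v) p q p' p' p' _ fun σ h₁ h₂ h₃ _ _ => ⟨?_, ?_⟩
    · rintro _ rfl
      simpa only [TLiteral.subst, FirstOrder.Language.Term.subst, h₁, h₃] using ih
    · simp only [TLiteral.subst, subst_alt, FirstOrder.Language.Term.subst, h₁, h₂, h₃]
  | @altRight p q q' v _ ih =>
    refine key (.altRight v) p q q' q' q' _ fun σ h₁ h₂ h₃ _ _ => ⟨?_, ?_⟩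
    · rintro _ rfl
      simpa only [TLiteral.subst, FirstOrder.Language.Term.subst, h₂, h₃] using ih
    · simp only [TLiteral.subst, subst_alt, FirstOrder.Language.Term.subst, h₁, h₂, h₃]
  | @seqLeft p q p' v hv _ ih =>
    refine key (.seqLeft v hv) p q p' p' p' _ fun σ h₁ h₂ h₃ _ _ => ⟨?_, ?_⟩
    · rintro _ rfl
      simpa only [TLiteral.subst, FirstOrder.Language.Term.subst, h₁, h₃] using ih
    · simp only [TLiteral.subst, subst_seq, FirstOrder.Language.Term.subst, h₁, h₂, h₃]
  | @seqRight p q p' q' v _ _ ih ih' =>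
    refine key (.seqRight v) p q p' p' q' _ fun σ h₁ h₂ _ h₄ h₅ => ⟨?_, ?_⟩
    · rintro _ (rfl | rfl)
      · simpa only [TLiteral.subst, FirstOrder.Language.Term.subst, h₁, h₄] using ih
      · simpa only [TLiteral.subst, FirstOrder.Language.Term.subst, h₂, h₅] using ih'
    · simp only [TLiteral.subst, subst_seq, FirstOrder.Language.Term.subst, h₁, h₂, h₅]
  | @starLeft p q p' v hv _ ih =>
    refine key (.starLeft v hv) p q p' p' p' _ fun σ h₁ h₂ h₃ _ _ => ⟨?_, ?_⟩
    · rintro _ rfl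
      simpa only [TLiteral.subst, FirstOrder.Language.Term.subst, h₁, h₃] using ih
    · simp only [TLiteral.subst, subst_seq, subst_star, FirstOrder.Language.Term.subst, h₁, h₂, h₃]
  | @starRight p q q' v _ ih =>
    refine key (.starRight v) p q q' q' q' _ fun σ h₁ h₂ h₃ _ _ => ⟨?_, ?_⟩
    · rintro _ rfl
      simpa only [TLiteral.subst, FirstOrder.Language.Term.subst, h₂, h₃] using ih
    · simp only [TLiteral.subst, subst_star, FirstOrder.Language.Term.subst, h₁, h₂, h₃]

theorem toLTS_tss (hV : [x₁, x₂, y, y₁, y₂].Nodup) :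
    (tss Act x₁ x₂ y y₁ y₂).toLTS = lts Act := by
  unfold TSS.toLTS lts
  congr 1
  funext p v q
  exact propext ⟨step_of_wsProvable, wsProvable_of_step hV⟩

end TSS

/-! ### Transitions and initials of composite processes -/

theorem alt_injective {p q p' q' : ClosedTerm Act} (h : alt p q = alt p' q') : p = p' ∧ q = q' := by
  simpa [alt] using h

theorem seq_injective {p q p' q' : ClosedTerm Act} (h : seq p q = seq p' q') : p = p' ∧ q = q' := by
  simpa [seq] using h

theorem star_injective {p q p' q' : ClosedTerm Act} (h : star p q = star p' q') :
    p = p' ∧ q = q' := by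
  simpa [star] using h

variable {p q r p' q' : ClosedTerm Act} {v : Label Act}

theorem step_alt_iff : (lts Act).step (alt p q) v r ↔
    (lts Act).step p v r ∨ (lts Act).step q v r := by
  refine ⟨fun h => ?_, fun h => h.elim .altLeft .altRight⟩
  change Step _ _ _ at h
  generalize hs : alt p q = s at h
  cases h
  case altLeft h => obtain ⟨rfl, rfl⟩ := alt_injective hs; exact .inl h
  case altRight h => obtain ⟨rfl, rfl⟩ := alt_injective hs; exact .inr h
  all_goals simp [alt, seq, star, act, eps] at hs

theorem step_seq_iff : (lts Act).step (seq p q) v r ↔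
    (v ≠ none ∧ ∃ p', (lts Act).step p v p' ∧ r = seq p' q) ∨
      (∃ p', (lts Act).step p none p') ∧ (lts Act).step q v r := by
  constructor
  · intro h
    change Step _ _ _ at h
    generalize hs : seq p q = s at h
    cases h
    case seqLeft hv h => obtain ⟨rfl, rfl⟩ := seq_injective hs; exact .inl ⟨hv, _, h, rfl⟩
    case seqRight h h' => obtain ⟨rfl, rfl⟩ := seq_injective hs; exact .inr ⟨⟨_, h⟩, h'⟩
    all_goals simp [alt, seq, star, act, eps] at hs
  · rintro (⟨hv, p', h, rfl⟩ | ⟨⟨p', h⟩, h'⟩)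
    · exact .seqLeft hv h
    · exact .seqRight h h'

theorem step_star_iff : (lts Act).step (star p q) v r ↔
    (v ≠ none ∧ ∃ p', (lts Act).step p v p' ∧ r = seq p' (star p q)) ∨
      (lts Act).step q v r := by
  constructor
  · intro h
    change Step _ _ _ at h
    generalize hs : star p q = s at h
    cases h
    case starLeft hv h => obtain ⟨rfl, rfl⟩ := star_injective hs; exact .inl ⟨hv, _, h, rfl⟩
    case starRight h => obtain ⟨rfl, rfl⟩ := star_injective hs; exact .inr h
    all_goals simp [alt, seq, star, act, eps] at hs
  · rintro (⟨hv, p', h, rfl⟩ | h)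
    · exact .starLeft hv h
    · exact .starRight h

/-- The initials of `p · q` in terms of those of `p` and `q`. -/
def seqInitials (I J : Set (Label Act)) : Set (Label Act) :=
  {v | v ≠ none ∧ v ∈ I ∨ none ∈ I ∧ v ∈ J}

/-- The initials of `p * q` in terms of those of `p` and `q`. -/
def starInitials (I J : Set (Label Act)) : Set (Label Act) :=
  {v | v ≠ none ∧ v ∈ I ∨ v ∈ J}

theorem initials_alt :
    (lts Act).initials (alt p q) = (lts Act).initials p ∪ (lts Act).initials q := by
  ext v
  simp only [LTS.initials, Set.mem_ofPred_eq, Set.mem_union, step_alt_iff, exists_or]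

theorem initials_seq :
    (lts Act).initials (seq p q) =
      seqInitials ((lts Act).initials p) ((lts Act).initials q) := by
  ext v
  simp only [LTS.initials, seqInitials, Set.mem_ofPred_eq, step_seq_iff]
  aesop

theorem initials_star :
    (lts Act).initials (star p q) =
      starInitials ((lts Act).initials p) ((lts Act).initials q) := by
  ext v
  simp only [LTS.initials, starInitials, Set.mem_ofPred_eq, step_star_iff]
  aesop

theorem isPrecongruence_of_binary {R : ClosedTerm Act → ClosedTerm Act → Prop} (refl : ∀ p, R p p)
    (trans : ∀ p q s, R p q → R q s → R p s)
    (alt_mono : ∀ p p' q q', R p p' → R q q' → R (alt p q) (alt p' q'))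
    (seq_mono : ∀ p p' q q', R p p' → R q q' → R (seq p q) (seq p' q'))
    (star_mono : ∀ p p' q q', R p p' → R q q' → R (star p q) (star p' q')) :
    IsPrecongruence R where
  refl := refl
  trans := trans
  func := by
    have nullary : ∀ (f : Symb Act 0) (p q : Fin 0 → ClosedTerm Act),
        R (.func (l := 0) f p) (.func (l := 0) f q) := by
      intro f p q
      rw [Subsingleton.elim p q]
      exact refl _
    have eta : ∀ p : Fin 2 → ClosedTerm Act, p = ![p 0, p 1] := by
      intro p
      funext i
      fin_cases i <;> rfl
    intro n f p q h
    cases f with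
    | act a => exact nullary _ p q
    | delta => exact nullary _ p q
    | eps => exact nullary _ p q
    | alt => rw [eta p, eta q]; exact alt_mono _ _ _ _ (h 0) (h 1)
    | seq => rw [eta p, eta q]; exact seq_mono _ _ _ _ (h 0) (h 1)
    | star => rw [eta p, eta q]; exact star_mono _ _ _ _ (h 0) (h 1)

theorem _root_.IsPrecongruence.binary {R : ClosedTerm Act → ClosedTerm Act → Prop}
    (h : IsPrecongruence R) (f : Symb Act 2) {p p' q q' : ClosedTerm Act} (hp : R p p')
    (hq : R q q') : R (.func (l := 2) f ![p, q]) (.func (l := 2) f ![p', q']) :=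
  h.func f _ _ fun i => by fin_cases i <;> assumption

theorem _root_.IsPrecongruence.flip {R : ClosedTerm Act → ClosedTerm Act → Prop}
    (h : IsPrecongruence R) : IsPrecongruence fun p q => R q p where
  refl := h.refl
  trans p q s h₁ h₂ := h.trans s q p h₂ h₁
  func f p q hpq := h.func f q p hpq

/-! ### Simulation preorders -/

/-- The closure of a relation under the binary operators. -/
inductive BinaryClosure (R : ClosedTerm Act → ClosedTerm Act → Prop) : ClosedTerm Act → ClosedTerm Act → Prop
  | base {p p' : ClosedTerm Act} (h : R p p') : BinaryClosure R p p'
  | alt {p p' q q' : ClosedTerm Act} (hp : BinaryClosure R p p') (hq : BinaryClosure R q q') :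
      BinaryClosure R (alt p q) (alt p' q')
  | seq {p p' q q' : ClosedTerm Act} (hp : BinaryClosure R p p') (hq : BinaryClosure R q q') :
      BinaryClosure R (seq p q) (seq p' q')
  | star {p p' q q' : ClosedTerm Act} (hp : BinaryClosure R p p') (hq : BinaryClosure R q q') :
      BinaryClosure R (star p q) (star p' q')

/-- Matching moves of composites lead to pairs built again by the operators. A left move of a star
leads to a sequential composition with the star itself, which is why the closure has to be iterated.
-/
theorem BinaryClosure.isSimulation {R : ClosedTerm Act → ClosedTerm Act → Prop}
    (hR : (lts Act).IsSimulation R) : (lts Act).IsSimulation (BinaryClosure R) := by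
  intro p q a p₁ h hp
  induction h generalizing a p₁ with
  | base h =>
    obtain ⟨q₁, hq, h₁⟩ := hR _ _ a p₁ h hp
    exact ⟨q₁, hq, .base h₁⟩
  | alt _ _ ihp ihq =>
    rcases step_alt_iff.1 hp with hs | hs
    · obtain ⟨r, hr, h⟩ := ihp a p₁ hs
      exact ⟨r, step_alt_iff.2 (.inl hr), h⟩
    · obtain ⟨r, hr, h⟩ := ihq a p₁ hs
      exact ⟨r, step_alt_iff.2 (.inr hr), h⟩
  | seq _ hq ihp ihq =>
    rcases step_seq_iff.1 hp with ⟨hv, p₂, hs, rfl⟩ | ⟨⟨p₂, hs⟩, hs'⟩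
    · obtain ⟨r, hr, h⟩ := ihp a p₂ hs
      exact ⟨_, step_seq_iff.2 (.inl ⟨hv, r, hr, rfl⟩), .seq h hq⟩
    · obtain ⟨r, hr, -⟩ := ihp none p₂ hs
      obtain ⟨r', hr', h⟩ := ihq a p₁ hs'
      exact ⟨r', step_seq_iff.2 (.inr ⟨⟨r, hr⟩, hr'⟩), h⟩
  | star hp' hq ihp ihq =>
    rcases step_star_iff.1 hp with ⟨hv, p₂, hs, rfl⟩ | hs
    · obtain ⟨r, hr, h⟩ := ihp a p₂ hs
      exact ⟨_, step_star_iff.2 (.inl ⟨hv, r, hr, rfl⟩), .seq h (.star hp' hq)⟩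
    · obtain ⟨r, hr, h⟩ := ihq a p₁ hs
      exact ⟨r, step_star_iff.2 (.inr hr), h⟩

theorem BinaryClosure.le {R S : ClosedTerm Act → ClosedTerm Act → Prop} (hS : IsPrecongruence S)
    (hR : ∀ p q, R p q → S p q) {p q : ClosedTerm Act} (h : BinaryClosure R p q) : S p q := by
  induction h with
  | base h => exact hR _ _ h
  | alt _ _ ihp ihq => exact hS.binary _ ihp ihq
  | seq _ _ ihp ihq => exact hS.binary _ ihp ihq
  | star _ _ ihp ihq => exact hS.binary _ ihp ihq

theorem isPrecongruence_simulationWithinLE {S : ClosedTerm Act → ClosedTerm Act → Prop}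
    (hS : IsPrecongruence S) : IsPrecongruence ((lts Act).simulationWithinLE S) := by
  have key : ∀ p q, BinaryClosure ((lts Act).simulationWithinLE S) p q →
      (lts Act).simulationWithinLE S p q := fun p q h =>
    ⟨_, BinaryClosure.isSimulation LTS.isSimulation_simulationWithinLE,
      fun _ _ => BinaryClosure.le hS fun _ _ => LTS.simulationWithinLE_le, h⟩
  exact isPrecongruence_of_binary (LTS.simulationWithinLE_refl hS.refl)
    (fun _ _ _ => LTS.simulationWithinLE_trans hS.trans)
    (fun _ _ _ _ hp hq => key _ _ (.alt (.base hp) (.base hq)))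
    (fun _ _ _ _ hp hq => key _ _ (.seq (.base hp) (.base hq)))
    (fun _ _ _ _ hp hq => key _ _ (.star (.base hp) (.base hq)))

theorem isPrecongruence_nestedSimulationLE (n : ℕ) :
    IsPrecongruence ((lts Act).nestedSimulationLE (n + 1)) := by
  induction n with
  | zero =>
    rw [LTS.nestedSimulationLE_one]
    exact isPrecongruence_simulationWithinLE
      ⟨fun _ => trivial, fun _ _ _ _ _ => trivial, fun _ _ _ _ => trivial⟩
  | succ n ih =>
    rw [LTS.nestedSimulationLE_succ]
    exact isPrecongruence_simulationWithinLE ih.flip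

theorem isPrecongruence_initials_subset :
    IsPrecongruence fun p q : ClosedTerm Act => (lts Act).initials q ⊆ (lts Act).initials p := by
  refine isPrecongruence_of_binary (fun _ => subset_rfl) (fun _ _ _ h₁ h₂ => h₂.trans h₁) ?_ ?_ ?_
  · intro p p' q q' hp hq
    rw [initials_alt, initials_alt]
    exact Set.union_subset_union hp hq
  · intro p p' q q' hp hq
    rw [initials_seq, initials_seq]
    exact fun v hv => hv.imp (fun h => ⟨h.1, hp h.2⟩) fun h => ⟨hp h.1, hq h.2⟩
  · intro p p' q q' hp hq
    rw [initials_star, initials_star]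
    exact fun v hv => hv.imp (fun h => ⟨h.1, hp h.2⟩) fun h => hq h

theorem isPrecongruence_readySimulationLE : IsPrecongruence (lts Act).readySimulationLE := by
  rw [LTS.readySimulationLE_eq]
  exact isPrecongruence_simulationWithinLE isPrecongruence_initials_subset

/-! ### Linear preorders -/

/-- A class of observations of initials that decomposes along all operators. -/
structure Compositional (C : Set (Set (Set (Label Act)))) : Prop where
  alt : Decomposes (· ∪ ·) C
  seq : Decomposes seqInitials C
  star : Decomposes starInitials C

theorem compositional_univ :
    Compositional ({Set.univ} : Set (Set (Set (Label Act)))) :=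
  ⟨.univ, .univ, .univ⟩

theorem compositional_exactly :
    Compositional (Set.range (LTS.exactly (A := Label Act))) :=
  ⟨.exactly, .exactly, .exactly⟩

theorem Compositional.union {C D : Set (Set (Set (Label Act)))} (hC : Compositional C)
    (hD : Compositional D) : Compositional (C ∪ D) :=
  ⟨hC.alt.union hD.alt, hC.seq.union hD.seq, hC.star.union hD.star⟩

theorem mem_refuses {A : Type*} {X I : Set A} : I ∈ LTS.refuses X ↔ ∀ v ∈ I, v ∉ X := by
  simp only [LTS.refuses, Set.mem_ofPred_eq, Set.eq_empty_iff_forall_notMem, Set.mem_inter_iff,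
    not_and]

theorem compositional_refuses :
    Compositional (Set.range (LTS.refuses (A := Label Act))) where
  alt := by
    rintro _ ⟨X, rfl⟩ I J h
    rw [mem_refuses] at h
    refine ⟨_, ⟨X, rfl⟩, _, ⟨X, rfl⟩, mem_refuses.2 fun v hv => h v (.inl hv),
      mem_refuses.2 fun v hv => h v (.inr hv), fun I' hI J' hJ => mem_refuses.2 ?_⟩
    rintro v (hv | hv)
    · exact mem_refuses.1 hI v hv
    · exact mem_refuses.1 hJ v hv
  seq := by
    rintro _ ⟨X, rfl⟩ I J h
    rw [mem_refuses] at h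
    by_cases hI : none ∈ I
    -- Termination of the left argument is not itself visible in the composite, so it need not be
    -- refused there.
    · refine ⟨_, ⟨X \ {none}, rfl⟩, _, ⟨X, rfl⟩,
        mem_refuses.2 fun v hv hX => h v (.inl ⟨hX.2, hv⟩) hX.1,
        mem_refuses.2 fun v hv => h v (.inr ⟨hI, hv⟩), fun I' hI' J' hJ' => mem_refuses.2 ?_⟩
      rintro v (⟨hne, hv⟩ | ⟨-, hv⟩) hX
      · exact mem_refuses.1 hI' v hv ⟨hX, hne⟩
      · exact mem_refuses.1 hJ' v hv hX
    -- If the left argument cannot terminate, refusing `none` shuts off the right argument, of which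
    -- nothing is then required.
    · refine ⟨_, ⟨insert none X, rfl⟩, _, ⟨∅, rfl⟩, mem_refuses.2 ?_,
        mem_refuses.2 fun _ _ h => h, fun I' hI' J' _ => mem_refuses.2 ?_⟩
      · rintro v hv (rfl | hX)
        · exact hI hv
        · exact h v (.inl ⟨fun hn => hI (hn ▸ hv), hv⟩) hX
      · rintro v (⟨-, hv⟩ | ⟨hn, -⟩) hX
        · exact mem_refuses.1 hI' v hv (.inr hX)
        · exact mem_refuses.1 hI' none hn (.inl rfl)
  star := by
    rintro _ ⟨X, rfl⟩ I J h
    rw [mem_refuses] at h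
    refine ⟨_, ⟨X \ {none}, rfl⟩, _, ⟨X, rfl⟩,
      mem_refuses.2 fun v hv hX => h v (.inl ⟨hX.2, hv⟩) hX.1,
      mem_refuses.2 fun v hv => h v (.inr hv), fun I' hI J' hJ => mem_refuses.2 ?_⟩
    rintro v (⟨hne, hv⟩ | hv) hX
    · exact mem_refuses.1 hI v hv ⟨hX, hne⟩
    · exact mem_refuses.1 hJ v hv hX

/-! ### Monotonicity of the operators for test preorders -/

section Linear

variable {M L : Set (Set (Set (Label Act)))}

theorem testLE_alt (hM : Compositional M) (hL : Compositional L) (hML : M ⊆ L) {k : ℕ}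
    (hp : (lts Act).testLE M L k p p') (hq : (lts Act).testLE M L k q q') :
    (lts Act).testLE M L k (alt p q) (alt p' q') := by
  intro φ hφ h
  cases hφ with
  | last k o ho =>
    rw [initials_alt] at h ⊢
    obtain ⟨o₁, h₁, o₂, h₂, hI, hJ, H⟩ := hL.alt o ho _ _ h
    exact H _ (hp _ (.last k o₁ h₁) hI) _ (hq _ (.last k o₂ h₂) hJ)
  | step k o ho a φ hφ =>
    obtain ⟨h, r, hr, hφr⟩ := h
    rw [initials_alt] at h ⊢
    obtain ⟨o₁, h₁, o₂, h₂, hI, hJ, H⟩ := hM.alt o ho _ _ h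
    -- The roots are fixed, so their initials can be checked by separate tests; `M ⊆ L` makes
    -- intermediate observations available as final ones.
    refine ⟨H _ (hp _ (.last _ o₁ (hML h₁)) hI) _ (hq _ (.last _ o₂ (hML h₂)) hJ), ?_⟩
    rcases step_alt_iff.1 hr with hs | hs
    · obtain ⟨-, r', hr', h'⟩ := hp _ (.step k o₁ h₁ a φ hφ) ⟨hI, r, hs, hφr⟩
      exact ⟨r', step_alt_iff.2 (.inl hr'), h'⟩
    · obtain ⟨-, r', hr', h'⟩ := hq _ (.step k o₂ h₂ a φ hφ) ⟨hJ, r, hs, hφr⟩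
      exact ⟨r', step_alt_iff.2 (.inr hr'), h'⟩

/-- A test passed by `p · q` is enforced by a test passed by `p`. -/
theorem exists_test_of_test_seq (hM : Compositional M) (hL : Compositional L) (hML : M ⊆ L)
    (htot : ∀ I, ∃ o ∈ L, I ∈ o) {k : ℕ} {φ : ClosedTerm Act → Prop} (hφ : (lts Act).Test M L k φ)
    (h : φ (seq p q)) :
    ∃ j ψ, (lts Act).Test M L j ψ ∧ ψ p ∧
      ∀ p' q', ψ p' → (lts Act).testLE M L k q q' → φ (seq p' q') := by
  induction hφ generalizing p with
  | last k o ho =>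
    rw [initials_seq] at h
    obtain ⟨o₁, h₁, o₂, h₂, hI, hJ, H⟩ := hL.seq o ho _ _ h
    refine ⟨0, _, .last 0 o₁ h₁, hI, fun p' q' hp hq => ?_⟩
    change (lts Act).initials (seq p' q') ∈ o
    rw [initials_seq]
    exact H _ hp _ (hq _ (.last k o₂ h₂) hJ)
  | step k o ho a φ hφ ih =>
    obtain ⟨h, r, hr, hφr⟩ := h
    rw [initials_seq] at h
    obtain ⟨o₁, h₁, o₂, h₂, hI, hJ, H⟩ := hM.seq o ho _ _ h
    rcases step_seq_iff.1 hr with ⟨hv, p₁, hs, rfl⟩ | ⟨⟨p₁, hs⟩, hs'⟩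
    · obtain ⟨j, ψ, hψ, hp₁, hψ'⟩ := ih hφr
      refine ⟨j + 1, _, .step j o₁ h₁ a ψ hψ, ⟨hI, p₁, hs, hp₁⟩, ?_⟩
      rintro p' q' ⟨hI', p₂, hs₂, hp₂⟩ hq
      refine ⟨?_, _, step_seq_iff.2 (.inl ⟨hv, p₂, hs₂, rfl⟩), hψ' p₂ q' hp₂ hq.of_succ⟩
      rw [initials_seq]
      exact H _ hI' _ (hq _ (.last _ o₂ (hML h₂)) hJ)
    -- The test has to end with some observation after termination; `o₃` serves only that purpose
    -- and is ignored afterwards.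
    · obtain ⟨o₃, h₃, hp₁⟩ := htot ((lts Act).initials p₁)
      refine ⟨1, _, .step 0 o₁ h₁ none _ (.last 0 o₃ h₃), ⟨hI, p₁, hs, hp₁⟩, ?_⟩
      rintro p' q' ⟨hI', p₂, hs₂, -⟩ hq
      obtain ⟨hJ', r', hr', h'⟩ := hq _ (.step k o₂ h₂ a φ hφ) ⟨hJ, r, hs', hφr⟩
      refine ⟨?_, r', step_seq_iff.2 (.inr ⟨⟨p₂, hs₂⟩, hr'⟩), h'⟩
      rw [initials_seq]
      exact H _ hI' _ hJ'

theorem testLE_star (hM : Compositional M) (hL : Compositional L) (hML : M ⊆ L)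
    (htot : ∀ I, ∃ o ∈ L, I ∈ o) (hp : ∀ k, (lts Act).testLE M L k p p')
    (hq : ∀ k, (lts Act).testLE M L k q q') (k : ℕ) :
    (lts Act).testLE M L k (star p q) (star p' q') := by
  induction k with
  | zero =>
    intro φ hφ h
    cases hφ with
    | last _ o ho =>
      rw [initials_star] at h ⊢
      obtain ⟨o₁, h₁, o₂, h₂, hI, hJ, H⟩ := hL.star o ho _ _ h
      exact H _ (hp 0 _ (.last 0 o₁ h₁) hI) _ (hq 0 _ (.last 0 o₂ h₂) hJ)
  | succ k ih =>
    intro φ hφ h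
    cases hφ with
    -- A final observation counts as a test of any depth, hence also of depth `k`.
    | last _ o ho => exact ih _ (.last k o ho) h
    | step _ o ho a φ hφ =>
      obtain ⟨h, r, hr, hφr⟩ := h
      rw [initials_star] at h ⊢
      obtain ⟨o₁, h₁, o₂, h₂, hI, hJ, H⟩ := hM.star o ho _ _ h
      refine ⟨H _ (hp 0 _ (.last _ o₁ (hML h₁)) hI) _ (hq 0 _ (.last _ o₂ (hML h₂)) hJ), ?_⟩
      rcases step_star_iff.1 hr with ⟨hv, p₁, hs, rfl⟩ | hs
      · obtain ⟨j, ψ, hψ, hp₁, hψ'⟩ := exists_test_of_test_seq hM hL hML htot hφ hφr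
        obtain ⟨-, p₂, hs₂, hp₂⟩ := hp _ _ (.step j o₁ h₁ a ψ hψ) ⟨hI, p₁, hs, hp₁⟩
        -- The remaining test has depth at most `k`, so `ih` compares the two stars as right-hand
        -- factors.
        exact ⟨_, step_star_iff.2 (.inl ⟨hv, p₂, hs₂, rfl⟩), hψ' p₂ _ hp₂ ih⟩
      · obtain ⟨-, r', hr', h'⟩ := hq _ _ (.step k o₂ h₂ a φ hφ) ⟨hJ, r, hs, hφr⟩
        exact ⟨r', step_star_iff.2 (.inr hr'), h'⟩

theorem isPrecongruence_testLE (hM : Compositional M) (hL : Compositional L) (hML : M ⊆ L)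
    (htot : ∀ I, ∃ o ∈ L, I ∈ o) :
    IsPrecongruence fun p q : ClosedTerm Act => ∀ k, (lts Act).testLE M L k p q := by
  refine isPrecongruence_of_binary (fun _ _ _ _ => id)
    (fun _ _ _ h₁ h₂ k φ hφ h => h₂ k φ hφ (h₁ k φ hφ h))
    (fun _ _ _ _ hp hq k => testLE_alt hM hL hML (hp k) (hq k)) ?_
    (fun _ _ _ _ hp hq => testLE_star hM hL hML htot hp hq)
  intro p p' q q' hp hq k φ hφ h
  obtain ⟨j, ψ, hψ, hψp, H⟩ := exists_test_of_test_seq hM hL hML htot hφ h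
  exact H p' q' (hp j ψ hψ hψp) (hq k)

end Linear

/-! ### The four linear preorders -/

theorem exists_mem_exactly (I : Set (Label Act)) : ∃ o ∈ Set.range LTS.exactly, I ∈ o :=
  ⟨_, ⟨I, rfl⟩, rfl⟩

theorem exists_mem_refuses (I : Set (Label Act)) : ∃ o ∈ Set.range LTS.refuses, I ∈ o :=
  ⟨_, ⟨∅, rfl⟩, Set.inter_empty I⟩

theorem isPrecongruence_readyTraceLE : IsPrecongruence (lts Act).readyTraceLE := by
  rw [LTS.readyTraceLE_eq]
  exact isPrecongruence_testLE compositional_exactly compositional_exactly subset_rfl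
    exists_mem_exactly

theorem isPrecongruence_readinessLE : IsPrecongruence (lts Act).readinessLE := by
  rw [LTS.readinessLE_eq]
  exact isPrecongruence_testLE compositional_univ (compositional_exactly.union compositional_univ)
    Set.subset_union_right fun _ => ⟨_, .inr rfl, trivial⟩

theorem isPrecongruence_failureTraceLE : IsPrecongruence (lts Act).failureTraceLE := by
  rw [LTS.failureTraceLE_eq]
  exact isPrecongruence_testLE compositional_refuses compositional_refuses subset_rfl
    exists_mem_refuses

theorem isPrecongruence_failureLE : IsPrecongruence (lts Act).failureLE := by
  rw [LTS.failureLE_eq]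
  refine isPrecongruence_testLE compositional_univ compositional_refuses ?_ exists_mem_refuses
  rintro _ rfl
  -- Refusing the empty set is the trivial observation.
  exact ⟨∅, Set.eq_univ_of_forall Set.inter_empty⟩

end BPAStar


theorem mainTheorem10 {Act V : Type*} (x₁ x₂ y y₁ y₂ : V)
    (hV : [x₁, x₂, y, y₁, y₂].Nodup) :
    (BPAStar.tss Act x₁ x₂ y y₁ y₂).Complete ∧
    (∀ n : ℕ, 1 ≤ n →
      IsPrecongruence ((BPAStar.tss Act x₁ x₂ y y₁ y₂).toLTS.nestedSimulationLE n)) ∧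
    IsPrecongruence (BPAStar.tss Act x₁ x₂ y y₁ y₂).toLTS.readySimulationLE ∧
    IsPrecongruence (BPAStar.tss Act x₁ x₂ y y₁ y₂).toLTS.readyTraceLE ∧
    IsPrecongruence (BPAStar.tss Act x₁ x₂ y y₁ y₂).toLTS.readinessLE ∧
    IsPrecongruence (BPAStar.tss Act x₁ x₂ y y₁ y₂).toLTS.failureTraceLE ∧
    IsPrecongruence (BPAStar.tss Act x₁ x₂ y y₁ y₂).toLTS.failureLE := by
  refine ⟨BPAStar.positive_tss.complete fun _ => BPAStar.delta, ?_⟩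
  rw [BPAStar.toLTS_tss hV]
  refine ⟨fun n hn => ?_, BPAStar.isPrecongruence_readySimulationLE,
    BPAStar.isPrecongruence_readyTraceLE, BPAStar.isPrecongruence_readinessLE,
    BPAStar.isPrecongruence_failureTraceLE, BPAStar.isPrecongruence_failureLE⟩
  obtain ⟨n, rfl⟩ := Nat.exists_eq_add_of_le' hn
  exact BPAStar.isPrecongruence_nestedSimulationLE n
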